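/- **Corollary (positive result for weak recovery).** For positive integers $k\le p$ and $n$, consider noiseless group testing with $p$ items: the defective set $S$ is uniformly distributed over the $\binom pk$ subsets of $\{1,\dots,p\}$ of size $k$; a non-adaptive design is a matrix $\mathbf X\in\{0,1\}^{n\times p}$ fixed before any outcome is observed, where $\mathbf X_{ij}=1$ means that item $j$ is included in test $i$; the outcomes are $Y_i=\bigvee_{j\in S}\mathbf X_{ij}$, $i=1,\dots,n$; and a decoder outputs an estimate $\hat S\subseteq\{1,\dots,p\}$ as a function of $\mathbf Y=(Y_1,\dots,Y_n)$ (knowing $p$, $k$ and $\mathbf X$). For every constant $c>0$ there is a constant $\delta>0$, depending only on $c$, such that the following holds. Let $k=k(p)$ and $n=n(p)$ be such that, as $p\to\infty$, $k\to\infty$, $k=o(p)$, and $n\ge c\,k\log\frac pk$ for all sufficiently large $p$. Then there exist non-adaptive designs $\mathbf X=\mathbf X(p)$ with $n(p)$ tests and decoders whose output $\hat S$ always has cardinality exactly $k$, such that $$\mathbb P\big[\,|\hat S\cap S|\ge \delta k\,\big]\to 1\qquad\text{as }p\to\infty .$$ -/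

import Mathlib

namespace GroupTesting

/-- The vector of outcomes of the `n` tests described by the matrix `X` (`X i j` says whether item
`j` is included in test `i`) when the set of defective items is `S`: the outcome of test `i` is the
disjunction of the entries `X i j` over `j ∈ S`. -/
def outcome {n p : ℕ} (X : Matrix (Fin n) (Fin p) Bool) (S : Finset (Fin p)) : Fin n → Bool :=
  fun i => decide (∃ j ∈ S, X i j = true)

/-- The probability that `A S` holds when `S` is uniform over the `k`-element subsets of the `p`
items. -/
noncomputable def uniformProb (p k : ℕ) (A : Finset (Fin p) → Prop) : ℝ :=
  ({S : Finset (Fin p) | S.card = k ∧ A S}.ncard : ℝ) / (p.choose k : ℝ)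

/-- The probability, over a uniformly random defective set `S` of size `k`, that the estimate
produced by the decoder `dec` from the outcomes of the tests in `X` contains at least `δ * k`
defective items. The matrix `X` is fixed before any outcome is seen (the design is non-adaptive);
the decoder may depend on `X`. -/
noncomputable def recoveryProb {n p : ℕ} (k : ℕ) (X : Matrix (Fin n) (Fin p) Bool)
    (dec : (Fin n → Bool) → Finset (Fin p)) (δ : ℝ) : ℝ :=
  uniformProb p k (fun S => δ * (k : ℝ) ≤ ((dec (outcome X S) ∩ S).card : ℝ))

end GroupTesting

namespace GroupTesting

/-! ### Binomial estimates -/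

/-! Test only part of the population. Take `m ≈ ηk` disjoint blocks of `B ≈ p/k` items and spend `L
= ⌈log₂ B⌉` tests on each, one per binary digit of an item's offset. A block with exactly one
defective spells out its offset (`exists_block_design`). Since `L ≤ 4 log (p/k)`, a small `η` keeps
`m * L` below `c k log (p/k)`.

A given block holds exactly one defective with probability at least `exp (-8)`
(`exp_neg_mul_choose_le`), and two such events have correlation ratio at most `p / (p - B) = 1 +
O(1/k)` (`choose_mul_choose_mul_le`). Chebyshev (`second_moment`) then gives at least `m exp (-8) /
2` good blocks outside probability `O(1/k)`, hence a constant fraction of `k`. -/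

theorem choose_mul_choose_le (A D r t : ℕ)
    (h : ∀ s, s < t → (D + s + 1) * (r + 1) ≤ (A + s + 1) * r) :
    (A + t).choose (r + 1) * D.choose r ≤ A.choose (r + 1) * (D + t).choose r := by
  induction t with
  | zero => simp
  | succ t ih =>
    have ih := ih fun s hs => h s (by omega)
    have ht := h t (by omega)
    by_cases hA : A + t + 1 ≤ r + 1
    · have : D + t + 1 ≤ r := by
        by_contra hc
        push Not at hc
        nlinarith
      rw [Nat.choose_eq_zero_of_lt (show D < r by omega)]
      simp
    have h1 := Nat.choose_mul_succ_eq (A + t) (r + 1)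
    have h2 := Nat.choose_mul_succ_eq (D + t) r
    obtain ⟨u, hu⟩ : ∃ u, A + t + 1 = r + 1 + u := Nat.exists_eq_add_of_le (by omega)
    have hu0 : 0 < u := by omega
    rw [show A + t + 1 - (r + 1) = u by omega] at h1
    rcases le_or_gt (D + t + 1) r with hd | hd
    · rw [Nat.choose_eq_zero_of_lt (show D < r by omega)]
      simp
    obtain ⟨v, hv⟩ : ∃ v, D + t + 1 = r + v := Nat.exists_eq_add_of_le (by omega)
    rw [show D + t + 1 - r = v by omega] at h2
    have hv0 : 0 < v := by omega
    -- Raising `t` by one multiplies the two binomials by `(A + t + 1) / u` and `(D + t + 1) / v`;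
    -- the hypothesis at `s = t` compares these ratios.
    have key : (A + t + 1) * v ≤ (D + t + 1) * u := by
      rw [hu, hv] at ht ⊢
      nlinarith
    rw [← add_assoc, ← add_assoc]
    refine Nat.le_of_mul_le_mul_right ?_ (Nat.mul_pos hu0 hv0)
    calc (A + t + 1).choose (r + 1) * D.choose r * (u * v)
        = ((A + t).choose (r + 1) * (A + t + 1)) * v * D.choose r := by rw [h1]; ring
      _ = ((A + t).choose (r + 1) * D.choose r) * ((A + t + 1) * v) := by ring
      _ ≤ (A.choose (r + 1) * (D + t).choose r) * ((D + t + 1) * u) := Nat.mul_le_mul ih key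
      _ = A.choose (r + 1) * ((D + t).choose r * (D + t + 1)) * u := by ring
      _ = A.choose (r + 1) * (D + t + 1).choose r * (u * v) := by rw [h2]; ring

/-- The quotient of the binomials is the product over `s < r` of `1 - d / (N - s)`, each factor at
least `1 - x`. -/
theorem pow_mul_choose_le (N d r : ℕ) (x : ℝ) (hx : x ≤ 1)
    (h : ∀ s : ℕ, s < r → (d : ℝ) ≤ x * ((N : ℝ) - s)) (hr : d + r ≤ N) :
    (1 - x) ^ r * (N.choose r : ℝ) ≤ ((N - d).choose r : ℝ) := by
  induction r with
  | zero => simp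
  | succ r ih =>
    have ih := ih (fun s hs => h s (by omega)) (by omega)
    have hs := h r (by omega)
    have h1 : (N.choose (r + 1) : ℝ) * (r + 1) = N.choose r * ((N : ℝ) - r) := by
      have := Nat.choose_succ_right_eq N r
      rw [← Nat.cast_sub (by omega)]
      exact_mod_cast this
    have h2 : ((N - d).choose (r + 1) : ℝ) * (r + 1) = (N - d).choose r * ((N : ℝ) - d - r) := by
      have := Nat.choose_succ_right_eq (N - d) r
      rw [← Nat.cast_sub (by omega), ← Nat.cast_sub (by omega)]
      exact_mod_cast this
    have hNr : (r : ℝ) + 1 + d ≤ N := by exact_mod_cast (by omega : r + 1 + d ≤ N)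
    have hd0 : (0 : ℝ) ≤ d := Nat.cast_nonneg d
    refine le_of_mul_le_mul_right ?_ (show (0 : ℝ) < r + 1 by positivity)
    calc (1 - x) ^ (r + 1) * (N.choose (r + 1) : ℝ) * (r + 1)
        = (1 - x) ^ (r + 1) * ((N.choose (r + 1) : ℝ) * (r + 1)) := by ring
      _ = ((1 - x) ^ r * N.choose r) * ((1 - x) * ((N : ℝ) - r)) := by rw [h1]; ring
      _ ≤ (N - d).choose r * ((N : ℝ) - d - r) := by
          refine mul_le_mul ih (by linarith) ?_ (by positivity)
          exact mul_nonneg (by linarith) (by linarith)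
      _ = _ := h2.symm

theorem exp_neg_le_one_sub_pow (k : ℕ) (hk : 8 ≤ k) :
    Real.exp (-8) ≤ (1 - 4 / (k : ℝ)) ^ (k - 1) := by
  have hk' : (8 : ℝ) ≤ k := by exact_mod_cast hk
  have hx : 4 / (k : ℝ) ≤ 1 / 2 := by rw [div_le_div_iff₀] <;> linarith
  have hx0 : 0 < 4 / (k : ℝ) := by positivity
  -- `exp (-2y) ≤ 1 - y` on `[0, 1/2]`; this range is why `k ≥ 8` is needed.
  have h1 : Real.exp (-(2 * (4 / (k : ℝ)))) ≤ 1 - 4 / (k : ℝ) := by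
    rw [Real.exp_neg, inv_le_comm₀ (Real.exp_pos _) (by linarith)]
    refine le_trans ?_ (Real.add_one_le_exp _)
    rw [inv_le_iff_one_le_mul₀ (by linarith)]
    nlinarith
  calc Real.exp (-8) = Real.exp (-(2 * (4 / (k : ℝ)))) ^ k := by
        rw [← Real.exp_nat_mul]; congr 1; field_simp; norm_num
    _ ≤ Real.exp (-(2 * (4 / (k : ℝ)))) ^ (k - 1) := by
        refine pow_le_pow_of_le_one (Real.exp_pos _).le ?_ (by omega)
        exact Real.exp_le_one_iff.2 (by linarith)
    _ ≤ _ := pow_le_pow_left₀ (Real.exp_pos _).le h1 _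

/-! ### Subsets meeting given blocks in exactly one point -/

open Finset in
/-- A subset meeting `A` in one point is that point together with its part outside `A`. -/
theorem card_filter_inter_card_eq_one {α : Type*} [DecidableEq α] (U A : Finset α) (hA : A ⊆ U)
    (k : ℕ) (Q : Finset α → Prop) [DecidablePred Q] :
    #{S ∈ U.powersetCard (k + 1) | #(S ∩ A) = 1 ∧ Q (S \ A)} =
      #A * #{T ∈ (U \ A).powersetCard k | Q T} := by
  have hp : #A = #(A.powersetCard 1) := by simp
  rw [hp, ← card_product]
  refine card_nbij' (fun S => (S ∩ A, S \ A)) (fun T => T.1 ∪ T.2) ?_ ?_ ?_ ?_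
  · intro S hS
    simp only [coe_filter, mem_powersetCard, Set.mem_ofPred_eq, coe_product, Set.mem_prod,
      mem_coe] at hS ⊢
    obtain ⟨⟨hSU, hc⟩, h1, hQ⟩ := hS
    refine ⟨⟨inter_subset_right, h1⟩, ⟨sdiff_subset_sdiff hSU le_rfl, ?_⟩, hQ⟩
    have := card_inter_add_card_sdiff S A
    omega
  · rintro ⟨T1, T2⟩ hT
    simp only [coe_filter, mem_powersetCard, Set.mem_ofPred_eq, coe_product, Set.mem_prod,
      mem_coe] at hT ⊢
    obtain ⟨⟨h1, hc1⟩, ⟨h2, hc2⟩, hQ⟩ := hT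
    have hd : Disjoint T2 A := disjoint_of_subset_left h2 sdiff_disjoint
    have e1 : (T1 ∪ T2) ∩ A = T1 := by
      rw [union_inter_distrib_right, disjoint_iff_inter_eq_empty.1 hd, union_empty,
        inter_eq_left.2 h1]
    have e2 : (T1 ∪ T2) \ A = T2 := by
      rw [union_sdiff_distrib, sdiff_eq_empty_iff_subset.2 h1, empty_union,
        sdiff_eq_self_of_disjoint hd]
    rw [e1, e2, card_union_of_disjoint (disjoint_of_subset_left h1 hd.symm)]
    exact ⟨⟨union_subset (h1.trans hA) (h2.trans sdiff_subset), by omega⟩, hc1, hQ⟩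
  · intro S _
    exact sup_inf_sdiff S A
  · rintro ⟨T1, T2⟩ hT
    simp only [coe_filter, mem_powersetCard, Set.mem_ofPred_eq, coe_product, Set.mem_prod,
      mem_coe] at hT
    obtain ⟨⟨h1, hc1⟩, ⟨h2, hc2⟩, hQ⟩ := hT
    have hd : Disjoint T2 A := disjoint_of_subset_left h2 sdiff_disjoint
    have e1 : (T1 ∪ T2) ∩ A = T1 := by
      rw [union_inter_distrib_right, disjoint_iff_inter_eq_empty.1 hd, union_empty,
        inter_eq_left.2 h1]
    have e2 : (T1 ∪ T2) \ A = T2 := by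
      rw [union_sdiff_distrib, sdiff_eq_empty_iff_subset.2 h1, empty_union,
        sdiff_eq_self_of_disjoint hd]
    simp only [e1, e2]

open Finset in
theorem card_filter_one {α : Type*} [DecidableEq α] (U A : Finset α) (hA : A ⊆ U) (k : ℕ) :
    #{S ∈ U.powersetCard (k + 1) | #(S ∩ A) = 1} = #A * (#U - #A).choose k := by
  have := card_filter_inter_card_eq_one U A hA k (fun _ => True)
  simpa [card_sdiff_of_subset hA] using this

open Finset in
theorem card_filter_one_and_one {α : Type*} [DecidableEq α] (U A A' : Finset α) (hA : A ⊆ U)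
    (hA' : A' ⊆ U) (hd : Disjoint A A') (k : ℕ) :
    #{S ∈ U.powersetCard (k + 2) | #(S ∩ A) = 1 ∧ #(S ∩ A') = 1} =
      #A * (#A' * (#U - #A - #A').choose k) := by
  have h := card_filter_inter_card_eq_one U A hA (k + 1) (fun T => #(T ∩ A') = 1)
  rw [card_filter_one (U \ A) A' (subset_sdiff.2 ⟨hA', hd.symm⟩), card_sdiff_of_subset hA] at h
  rw [← h]
  congr 1
  refine filter_congr fun S _ => ?_
  have : S \ A ∩ A' = S ∩ A' := by
    ext x
    have := fun h : x ∈ A' => Finset.disjoint_right.1 hd h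
    simp only [mem_inter, mem_sdiff]
    tauto
  rw [this]

/-! ### Second moment method -/

open Finset in
/-- Chebyshev's inequality for the number of events that occur at a uniform point of `Ω`. -/
theorem second_moment {α : Type*} (Ω : Finset α) (m : ℕ) (G : Fin m → α → Prop)
    [∀ i, DecidablePred (G i)] (a b : ℝ) (ha : ∀ i, (#{S ∈ Ω | G i S} : ℝ) = a)
    (hb : ∀ i j, i ≠ j → (#{S ∈ Ω | G i S ∧ G j S} : ℝ) ≤ b) (hb0 : 0 ≤ b) (ha0 : 0 < a)
    (hm : 0 < m) (hΩ : 0 < #Ω) :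
    (#{S ∈ Ω | (#{i | G i S} : ℝ) < m * a / (2 * #Ω)} : ℝ) / #Ω ≤
      4 * #Ω / (m * a) + 4 * (#Ω * b / a ^ 2 - 1) := by
  classical
  set M : ℝ := (#Ω : ℝ) with hM
  have hM0 : 0 < M := by rw [hM]; exact_mod_cast hΩ
  have hm0 : (0 : ℝ) < m := by exact_mod_cast hm
  set N : α → ℝ := fun S => (#{i | G i S} : ℝ) with hN
  have hNs : ∀ S, N S = ∑ i, if G i S then (1 : ℝ) else 0 := by
    intro S; simp [hN, Finset.sum_boole]
  have s1 : ∑ S ∈ Ω, N S = m * a := by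
    simp_rw [hNs]
    rw [sum_comm]
    simp_rw [Finset.sum_boole, ha]
    simp
  have s2 : ∑ S ∈ Ω, N S ^ 2 ≤ m * a + m ^ 2 * b := by
    have e : ∀ S, N S ^ 2 = ∑ i, ∑ j, if G i S ∧ G j S then (1 : ℝ) else 0 := by
      intro S
      rw [sq, hNs, sum_mul_sum]
      refine sum_congr rfl fun i _ => sum_congr rfl fun j _ => ?_
      by_cases h1 : G i S <;> by_cases h2 : G j S <;> simp [h1, h2]
    simp_rw [e]
    rw [sum_comm]
    -- The diagonal term is charged `a + b`, a harmless excess that avoids the factor `m - 1`.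
    have hi : ∀ i : Fin m, ∑ S ∈ Ω, ∑ j, (if G i S ∧ G j S then (1 : ℝ) else 0) ≤ a + m * b := by
      intro i
      rw [sum_comm]
      simp_rw [Finset.sum_boole]
      calc ∑ j, (#{S ∈ Ω | G i S ∧ G j S} : ℝ) ≤ ∑ j, ((if i = j then a else 0) + b) := by
            refine sum_le_sum fun j _ => ?_
            by_cases h : i = j
            · subst h
              simp only [and_self, ha, if_true]
              linarith
            · simpa [h] using hb i j h
        _ = a + m * b := by rw [sum_add_distrib]; simp
    calc _ ≤ ∑ i : Fin m, (a + m * b) := sum_le_sum fun i _ => hi i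
      _ = m * a + m ^ 2 * b := by simp; ring
  have s3 : ∑ S ∈ Ω, (N S - m * a / M) ^ 2 ≤ m * a + m ^ 2 * b - (m * a) ^ 2 / M := by
    have e : ∑ S ∈ Ω, (N S - m * a / M) ^ 2
        = ∑ S ∈ Ω, N S ^ 2 - 2 * (m * a / M) * ∑ S ∈ Ω, N S + M * (m * a / M) ^ 2 := by
      simp_rw [sub_sq, sum_add_distrib, sum_sub_distrib, sum_const, nsmul_eq_mul, mul_sum]
      congr 2
      exact sum_congr rfl fun S _ => by ring
    rw [e, s1]
    have : 2 * (m * a / M) * (m * a) - M * (m * a / M) ^ 2 = (m * a) ^ 2 / M := by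
      field_simp; ring
    linarith
  have s4 : (#{S ∈ Ω | N S < m * a / (2 * M)} : ℝ) * (m * a / (2 * M)) ^ 2
      ≤ ∑ S ∈ Ω, (N S - m * a / M) ^ 2 := by
    rw [← nsmul_eq_mul, ← sum_const]
    refine le_trans (sum_le_sum fun S hS => ?_)
      (sum_le_sum_of_subset_of_nonneg (filter_subset (fun S => N S < m * a / (2 * M)) Ω)
        fun _ _ _ => sq_nonneg _)
    have h := (mem_filter.1 hS).2
    have e : m * a / M = 2 * (m * a / (2 * M)) := by field_simp
    have h0 : 0 < m * a / (2 * M) := by positivity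
    rw [e]
    nlinarith
  have s5 := s4.trans s3
  have hc : 0 < (m * a / (2 * M)) ^ 2 := by positivity
  rw [← le_div_iff₀ hc] at s5
  rw [div_le_iff₀ hM0]
  refine s5.trans (le_of_eq ?_)
  field_simp
  ring

/-! ### The block design -/

/-- The `i`-th block of `B` consecutive items. -/
def block (p B i : ℕ) : Finset (Fin p) := {j | j.val / B = i}

open Finset in
theorem card_block {p B i : ℕ} (hB : 0 < B) (h : (i + 1) * B ≤ p) : #(block p B i) = B := by
  conv_rhs => rw [← card_range B]
  refine card_bij (fun j _ => j.val % B) ?_ ?_ ?_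
  · intro j _
    exact mem_range.2 (Nat.mod_lt _ hB)
  · intro j hj j' hj' e
    simp only [block, mem_filter, mem_univ, true_and] at hj hj'
    ext
    rw [← Nat.div_add_mod j.val B, ← Nat.div_add_mod j'.val B, hj, hj', e]
  · intro r hr
    have hr := mem_range.1 hr
    refine ⟨⟨B * i + r, by nlinarith⟩, ?_, ?_⟩
    · simp [block, Nat.mul_add_div hB, Nat.div_eq_of_lt hr]
    · simp [Nat.mod_eq_of_lt hr]

open Finset in
theorem disjoint_block {p B i j : ℕ} (h : i ≠ j) : Disjoint (block p B i) (block p B j) := by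
  rw [Finset.disjoint_left]
  intro x hx hy
  simp only [block, mem_filter, mem_univ, true_and] at hx hy
  exact h (hx.symm.trans hy)

open Finset in
/-- Writing the position of an item inside its block in binary, with one test for each bit, reveals
the defective item of every block that contains exactly one. -/
theorem exists_block_design {p k m B L n : ℕ} (hB : 0 < B) (hL : B ≤ 2 ^ L) (hn : m * L ≤ n)
    (hmk : m ≤ k) (hkp : k ≤ p) :
    ∃ (X : Matrix (Fin n) (Fin p) Bool) (dec : (Fin n → Bool) → Finset (Fin p)),
      (∀ y, #(dec y) = k) ∧
      ∀ S : Finset (Fin p), #{i : Fin m | #(S ∩ block p B i) = 1} ≤ #(dec (outcome X S) ∩ S) := by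
  let X : Matrix (Fin n) (Fin p) Bool := fun t j =>
    decide (j.val / B = t.val / L) && Nat.testBit (j.val % B) (t.val % L)
  -- Items of tested blocks whose offset digits match the outcomes: at most one per block, as `B ≤ 2
  -- ^ L`. The decoder pads this set to size `k`.
  let T : (Fin n → Bool) → Finset (Fin p) := fun y =>
    {j | j.val / B < m ∧ ∀ b < L, ∀ t : Fin n, t.val = L * (j.val / B) + b →
      y t = Nat.testBit (j.val % B) b}
  have hT : ∀ y, #(T y) ≤ k := by
    intro y
    refine le_trans ?_ hmk
    rw [← card_range m]
    refine card_le_card_of_injOn (fun j => j.val / B) ?_ ?_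
    · intro j hj
      simp only [T, coe_filter, mem_univ, true_and, Set.mem_ofPred_eq] at hj
      simpa using hj.1
    · intro j hj j' hj' e
      simp only [T, coe_filter, mem_univ, true_and, Set.mem_ofPred_eq] at hj hj' e
      have hm : j.val % B = j'.val % B := by
        refine Nat.eq_of_testBit_eq fun b => ?_
        rcases lt_or_ge b L with hb | hb
        · have hlt : L * (j.val / B) + b < n := by
            have : (j.val / B + 1) * L ≤ m * L := Nat.mul_le_mul_right _ hj.1
            nlinarith
          rw [← hj.2 b hb ⟨_, hlt⟩ rfl, ← hj'.2 b hb ⟨_, hlt⟩ (by rw [← e])]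
        · have hp : 2 ^ L ≤ 2 ^ b := Nat.pow_le_pow_right (by norm_num) hb
          rw [Nat.testBit_lt_two_pow ((Nat.mod_lt _ hB).trans_le (hL.trans hp)),
            Nat.testBit_lt_two_pow ((Nat.mod_lt _ hB).trans_le (hL.trans hp))]
      ext
      rw [← Nat.div_add_mod j.val B, ← Nat.div_add_mod j'.val B, e, hm]
  have hD : ∀ y, ∃ D, T y ⊆ D ∧ #D = k := fun y => by
    obtain ⟨D, h1, _, h2⟩ :=
      exists_subsuperset_card_eq (subset_univ (T y)) (hT y) (by simpa using hkp)
    exact ⟨D, h1, h2⟩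
  choose dec hsub hcard using hD
  refine ⟨X, dec, hcard, fun S => ?_⟩
  have hex : ∀ i : Fin m, #(S ∩ block p B i) = 1 →
      ∃ j, j ∈ dec (outcome X S) ∩ S ∧ j.val / B = i := by
    intro i hi
    obtain ⟨j, hj⟩ := card_eq_one.1 hi
    have hmem : ∀ x : Fin p, (x ∈ S ∧ x.val / B = i) ↔ x = j := by
      intro x
      have := Finset.ext_iff.1 hj x
      simpa [block] using this
    obtain ⟨hjS, hji⟩ := (hmem j).2 rfl
    refine ⟨j, mem_inter.2 ⟨hsub _ ?_, hjS⟩, hji⟩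
    simp only [T, mem_filter, mem_univ, true_and]
    refine ⟨hji ▸ i.2, fun b hb t ht => ?_⟩
    have h1 : t.val / L = i := by
      rw [ht, Nat.mul_add_div (by omega), Nat.div_eq_of_lt hb, hji, add_zero]
    have h2 : t.val % L = b := by rw [ht, Nat.mul_add_mod, Nat.mod_eq_of_lt hb]
    rw [Bool.eq_iff_iff]
    simp only [outcome, X, h1, h2, decide_eq_true_eq, Bool.and_eq_true]
    constructor
    · rintro ⟨x, hx, hxi, hbit⟩
      rwa [← (hmem x).1 ⟨hx, hxi⟩]
    · exact fun h => ⟨j, hjS, hji, h⟩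
  -- `choose!` below needs a default item.
  rcases isEmpty_or_nonempty (Fin p) with _ | _
  · rw [filter_false_of_mem fun i _ hi => (hex i hi).elim fun j _ => isEmptyElim j]
    simp
  choose! f hf hfi using hex
  refine card_le_card_of_injOn f ?_ ?_
  · intro i hi
    exact hf i (by simpa using hi)
  · intro i hi i' hi' e
    ext
    rw [← hfi i (by simpa using hi), ← hfi i' (by simpa using hi'), e]

/-! ### Moments of the number of blocks with a single defective -/

/-- The probability in question is `Bk/p`, at least `1`, times `C(p-B, k-1) / C(p-1, k-1)`, at least
`(1 - 4/k)^(k-1)`. -/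
theorem exp_neg_mul_choose_le {p k B : ℕ} (hk : 8 ≤ k) (hp : 4 * k ≤ p) (hB : 0 < B)
    (hB1 : p ≤ B * (k - 1)) (hB2 : B * k ≤ 2 * p) :
    Real.exp (-8) * (p.choose k : ℝ) ≤ (B * (p - B).choose (k - 1) : ℕ) := by
  obtain ⟨r, rfl⟩ : ∃ r, k = r + 1 := ⟨k - 1, by omega⟩
  obtain ⟨q, rfl⟩ : ∃ q, p = q + 1 := ⟨p - 1, by omega⟩
  obtain ⟨d, rfl⟩ : ∃ d, B = d + 1 := ⟨B - 1, by omega⟩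
  simp only [Nat.add_sub_cancel, Nat.add_sub_add_right] at *
  have hk' : (8 : ℝ) ≤ ((r + 1 : ℕ) : ℝ) := by exact_mod_cast hk
  have hk0 : (0 : ℝ) < ((r + 1 : ℕ) : ℝ) := by linarith
  have hp' : 4 * ((r + 1 : ℕ) : ℝ) ≤ (q : ℝ) + 1 := by exact_mod_cast hp
  have hB2' : ((d : ℝ) + 1) * ((r + 1 : ℕ) : ℝ) ≤ 2 * ((q : ℝ) + 1) := by exact_mod_cast hB2
  have h1 := pow_mul_choose_le q d r (4 / ((r + 1 : ℕ) : ℝ))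
    (by rw [div_le_one hk0]; linarith)
    (fun s hs => by
      have hs' : (s : ℝ) + 1 ≤ ((r + 1 : ℕ) : ℝ) := by exact_mod_cast (by omega : s + 1 ≤ r + 1)
      rw [div_mul_eq_mul_div, le_div_iff₀ hk0]
      nlinarith)
    (by nlinarith)
  have h2 := exp_neg_le_one_sub_pow (r + 1) hk
  rw [Nat.add_sub_cancel] at h2
  have h3 : Real.exp (-8) * (q.choose r : ℝ) ≤ ((q - d).choose r : ℝ) :=
    (mul_le_mul_of_nonneg_right h2 (Nat.cast_nonneg _)).trans h1
  have h4 : ((q : ℝ) + 1) * q.choose r = (q + 1).choose (r + 1) * ((r : ℝ) + 1) := by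
    exact_mod_cast Nat.add_one_mul_choose_eq q r
  have h5 : (q : ℝ) + 1 ≤ ((d : ℝ) + 1) * ((r : ℝ) + 1) := by
    have : q + 1 ≤ (d + 1) * (r + 1) := hB1.trans (Nat.mul_le_mul_left _ (Nat.le_succ r))
    exact_mod_cast this
  push_cast
  refine le_of_mul_le_mul_right ?_ (show (0 : ℝ) < (r : ℝ) + 1 by positivity)
  calc Real.exp (-8) * ((q + 1).choose (r + 1) : ℝ) * ((r : ℝ) + 1)
      = ((q : ℝ) + 1) * (Real.exp (-8) * q.choose r) := by rw [mul_assoc, ← h4]; ring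
    _ ≤ (((d : ℝ) + 1) * ((r : ℝ) + 1)) * ((q - d).choose r : ℝ) := by gcongr
    _ = _ := by ring

theorem choose_mul_choose_mul_le {p k B : ℕ} (hk : 2 ≤ k) (hB : 0 < B) (hBp : 2 * B ≤ p)
    (hB1 : p ≤ B * (k - 1)) :
    p.choose k * (p - B - B).choose (k - 2) * (p - B) ≤ p * (p - B).choose (k - 1) ^ 2 := by
  obtain ⟨r, rfl⟩ : ∃ r, k = r + 2 := ⟨k - 2, by omega⟩
  obtain ⟨t, rfl⟩ : ∃ t, B = t + 1 := ⟨B - 1, by omega⟩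
  obtain ⟨D, rfl⟩ : ∃ D, p = D + 2 * (t + 1) := ⟨p - 2 * (t + 1), by omega⟩
  rw [show D + 2 * (t + 1) - (t + 1) = D + t + 1 by omega,
    show D + t + 1 - (t + 1) = D by omega, show r + 2 - 1 = r + 1 by omega,
    show r + 2 - 2 = r by omega] at *
  -- The ratio condition reduces to `D + s + 1 ≤ B * (k - 2)`, which is where `p ≤ B * (k - 1)`,
  -- rather than `p ≤ B * k`, is used.
  have h := choose_mul_choose_le (D + t + 1) D r t fun s hs => by nlinarith
  have e1 := Nat.add_one_mul_choose_eq (D + t + 1 + t) (r + 1)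
  have e2 := Nat.add_one_mul_choose_eq (D + t) r
  rw [show D + 2 * (t + 1) = D + t + 1 + t + 1 by omega]
  refine Nat.le_of_mul_le_mul_right ?_ (show 0 < r + 1 + 1 by omega)
  calc (D + t + 1 + t + 1).choose (r + 2) * D.choose r * (D + t + 1) * (r + 1 + 1)
      = ((D + t + 1 + t + 1).choose (r + 1 + 1) * (r + 1 + 1)) * D.choose r * (D + t + 1) := by ring
    _ = (D + t + 1 + t + 1) * (D + t + 1) * ((D + t + 1 + t).choose (r + 1) * D.choose r) := by
        rw [← e1]; ring
    _ ≤ (D + t + 1 + t + 1) * (D + t + 1) * ((D + t + 1).choose (r + 1) * (D + t).choose r) :=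
        Nat.mul_le_mul_left _ h
    _ = (D + t + 1 + t + 1) * (D + t + 1).choose (r + 1) * ((D + t + 1) * (D + t).choose r) := by
        ring
    _ = (D + t + 1 + t + 1) * (D + t + 1).choose (r + 1) ^ 2 * (r + 1) := by rw [e2]; ring
    _ ≤ _ := Nat.mul_le_mul_left _ (Nat.le_succ _)

open Finset in
/-- All but a vanishing fraction of the `k`-subsets meet a constant proportion of the blocks in
exactly one item. -/
theorem card_few_singleton_blocks_le {p k m B : ℕ} (hk : 8 ≤ k) (hp : 4 * k ≤ p) (hB : 0 < B)
    (hB1 : p ≤ B * (k - 1)) (hB2 : B * k ≤ 2 * p) (hm : 0 < m) (hmB : m * B ≤ p) :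
    (#{S ∈ (univ : Finset (Fin p)).powersetCard k |
        (#{i : Fin m | #(S ∩ block p B i) = 1} : ℝ) < m * Real.exp (-8) / 2} : ℝ) / p.choose k ≤
      4 * Real.exp 8 / m + 16 / k := by
  set M : ℝ := (p.choose k : ℝ) with hM
  set a : ℝ := ((B * (p - B).choose (k - 1) : ℕ) : ℝ) with ha
  set b : ℝ := ((B * (B * (p - B - B).choose (k - 2)) : ℕ) : ℝ) with hb
  have hM0 : 0 < M := by rw [hM]; exact_mod_cast Nat.choose_pos (by omega : k ≤ p)
  have haM : Real.exp (-8) * M ≤ a := exp_neg_mul_choose_le hk hp hB hB1 hB2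
  have ha0 : 0 < a := lt_of_lt_of_le (by positivity) haM
  have hm0 : (0 : ℝ) < m := by exact_mod_cast hm
  have hk0 : (0 : ℝ) < k := by exact_mod_cast (by omega : 0 < k)
  have hcard : #((univ : Finset (Fin p)).powersetCard k) = p.choose k := by simp
  have hbl : ∀ i : Fin m, #(block p B i) = B := fun i =>
    card_block hB ((Nat.mul_le_mul_right _ i.2).trans hmB)
  have hs := second_moment ((univ : Finset (Fin p)).powersetCard k) m
    (fun i S => #(S ∩ block p B i) = 1) a b
    (fun i => by
      obtain ⟨r, rfl⟩ : ∃ r, k = r + 1 := ⟨k - 1, by omega⟩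
      rw [card_filter_one _ _ (subset_univ _), hbl, card_univ, Fintype.card_fin]
      rfl)
    (fun i j hij => by
      obtain ⟨r, rfl⟩ : ∃ r, k = r + 2 := ⟨k - 2, by omega⟩
      rw [card_filter_one_and_one _ _ _ (subset_univ _) (subset_univ _)
        (disjoint_block (fun h => hij (Fin.ext h))), hbl, hbl, card_univ, Fintype.card_fin]
      rfl)
    (Nat.cast_nonneg _) ha0 hm (by rw [hcard]; exact Nat.choose_pos (by omega))
  rw [hcard, ← hM] at hs
  have hq : (m : ℝ) * Real.exp (-8) / 2 ≤ m * a / (2 * M) := by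
    rw [div_le_div_iff₀ two_pos (by positivity)]
    nlinarith
  have hB4 : 4 * B ≤ p := by nlinarith
  have hratio : M * b / a ^ 2 - 1 ≤ 4 / k := by
    have h := choose_mul_choose_mul_le (by omega : 2 ≤ k) hB (by omega) hB1
    have h' : (M * (p - B - B).choose (k - 2) : ℝ) * ((p : ℝ) - B)
        ≤ p * ((p - B).choose (k - 1) : ℝ) ^ 2 := by
      rw [hM, ← Nat.cast_sub (by omega)]
      exact_mod_cast h
    have hB4' : 4 * (B : ℝ) ≤ p := by exact_mod_cast hB4
    have hB2' : (B : ℝ) * k ≤ 2 * p := by exact_mod_cast hB2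
    have hB0 : (0 : ℝ) < B := by exact_mod_cast hB
    have hpB : (0 : ℝ) < (p : ℝ) - B := by linarith
    have h1 : M * b / a ^ 2 ≤ p / ((p : ℝ) - B) := by
      rw [div_le_div_iff₀ (by positivity) hpB, ha, hb]
      push_cast
      nlinarith [mul_le_mul_of_nonneg_left h' (sq_nonneg (B : ℝ))]
    have h2 : (p : ℝ) / ((p : ℝ) - B) - 1 ≤ 4 / k := by
      rw [div_sub_one hpB.ne', div_le_div_iff₀ hpB hk0]
      linarith
    linarith
  have hfirst : 4 * M / (m * a) ≤ 4 * Real.exp 8 / m := by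
    rw [div_le_div_iff₀ (by positivity) hm0]
    have : M ≤ Real.exp 8 * a := by
      have := mul_le_mul_of_nonneg_left haM (Real.exp_pos 8).le
      rwa [← mul_assoc, ← Real.exp_add, add_neg_cancel, Real.exp_zero, one_mul] at this
    nlinarith
  refine le_trans ?_ (hs.trans ?_)
  · refine div_le_div_of_nonneg_right ?_ hM0.le
    refine Nat.cast_le.2 (card_le_card fun S hS => ?_)
    rw [mem_filter] at hS ⊢
    exact ⟨hS.1, hS.2.trans_le hq⟩
  · have : 16 / (k : ℝ) = 4 * (4 / k) := by ring
    rw [this]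
    linarith

open Finset in
theorem uniformProb_le_one {p k : ℕ} (hkp : k ≤ p) (A : Finset (Fin p) → Prop) :
    uniformProb p k A ≤ 1 := by
  classical
  have h0 : (0 : ℝ) < p.choose k := by exact_mod_cast Nat.choose_pos hkp
  rw [uniformProb, div_le_one h0]
  have h : {S : Finset (Fin p) | S.card = k ∧ A S} =
      ({S ∈ (univ : Finset (Fin p)).powersetCard k | A S} : Finset _) := by
    ext S; simp [mem_powersetCard]
  rw [h, Set.ncard_coe_finset]
  refine Nat.cast_le.2 ((card_filter_le _ _).trans_eq (by simp))

open Finset in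
/-- The block design with `m` blocks recovers a constant multiple of `m` defective items with
high probability. -/
theorem exists_recoveryProb_ge {p k m B L n : ℕ} {δ : ℝ} (hk : 8 ≤ k) (hp : 4 * k ≤ p)
    (hB : 0 < B) (hB1 : p ≤ B * (k - 1)) (hB2 : B * k ≤ 2 * p) (hm : 0 < m) (hmk : 2 * m ≤ k)
    (hL : B ≤ 2 ^ L) (hn : m * L ≤ n) (hδ : δ * k ≤ m * Real.exp (-8) / 2) :
    ∃ (X : Matrix (Fin n) (Fin p) Bool) (dec : (Fin n → Bool) → Finset (Fin p)),
      (∀ y, #(dec y) = k) ∧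
      1 - (4 * Real.exp 8 / m + 16 / k) ≤ recoveryProb k X dec δ := by
  classical
  obtain ⟨X, dec, h1, h2⟩ := exists_block_design (p := p) (k := k) hB hL hn (by omega) (by omega)
  refine ⟨X, dec, h1, ?_⟩
  have hmB : m * B ≤ p := by nlinarith
  have hbad := card_few_singleton_blocks_le hk hp hB hB1 hB2 hm hmB
  have h0 : (0 : ℝ) < p.choose k := by exact_mod_cast Nat.choose_pos (by omega : k ≤ p)
  have hsum := card_filter_add_card_filter_not (s := (univ : Finset (Fin p)).powersetCard k)
    (fun S => (#{i : Fin m | #(S ∩ block p B i) = 1} : ℝ) < m * Real.exp (-8) / 2)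
  rw [card_powersetCard, card_univ, Fintype.card_fin] at hsum
  have hsum' := congrArg (Nat.cast (R := ℝ)) hsum
  push_cast at hsum'
  refine le_trans (sub_le_sub_left hbad 1) ?_
  rw [recoveryProb, uniformProb, one_sub_div h0.ne']
  refine div_le_div_of_nonneg_right ?_ h0.le
  rw [sub_le_iff_le_add', ← hsum']
  refine add_le_add_right ?_ _
  rw [← Set.ncard_coe_finset]
  refine Nat.cast_le.2 (Set.ncard_le_ncard ?_ (Set.toFinite _))
  intro S hS
  simp only [coe_filter, mem_powersetCard, not_lt, Set.mem_ofPred_eq] at hS ⊢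
  exact ⟨hS.1.2, hδ.trans (hS.2.trans (Nat.cast_le.2 (h2 S)))⟩

/-! ### Choice of parameters -/

theorem clog_le_four_mul_log {B : ℕ} {x : ℝ} (hx : 4 ≤ x) (hB : (B : ℝ) ≤ 2 * x) :
    (Nat.clog 2 B : ℝ) ≤ 4 * Real.log x := by
  have hlx : 2 * Real.log 2 ≤ Real.log x := by
    have := Real.log_le_log (by norm_num) hx
    rwa [show (4 : ℝ) = 2 ^ 2 by norm_num, Real.log_pow, Nat.cast_ofNat] at this
  have hl2 : 1 / 2 < Real.log 2 := by linarith [Real.log_two_gt_d9]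
  rcases le_or_gt B 1 with h | h
  · rw [Nat.clog_of_right_le_one h]
    push_cast
    linarith
  have h1 : 2 ^ (Nat.clog 2 B - 1) < B := Nat.pow_pred_clog_lt_self one_lt_two h
  have h2 : (2 : ℝ) ^ (Nat.clog 2 B - 1) ≤ 2 * x := by
    refine le_trans ?_ hB
    exact_mod_cast h1.le
  have h3 := Real.log_le_log (by positivity) h2
  have hpos : 0 < Nat.clog 2 B := Nat.clog_pos one_lt_two h
  rw [Real.log_pow, Real.log_mul two_ne_zero (by linarith), Nat.cast_sub hpos, Nat.cast_one] at h3
  nlinarith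

open Finset in
theorem exists_recoveryProb_ge_of_le {p k n : ℕ} {c η : ℝ} (hη : 0 < η) (hηc : η ≤ c / 4)
    (hη2 : η ≤ 1 / 2) (hk : 8 ≤ k) (hkη : 2 ≤ η * k) (hp : 4 * k ≤ p)
    (hn : c * (k * Real.log (p / k)) ≤ n) :
    ∃ (X : Matrix (Fin n) (Fin p) Bool) (dec : (Fin n → Bool) → Finset (Fin p)),
      (∀ y, #(dec y) = k) ∧
      1 - (8 * Real.exp 8 / η + 16) / k ≤ recoveryProb k X dec (η * Real.exp (-8) / 4) := by
  have hk0 : (0 : ℝ) < k := by exact_mod_cast (by omega : 0 < k)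
  have hm1 : (⌊η * k⌋₊ : ℝ) ≤ η * k := Nat.floor_le (by positivity)
  have hm2 : η * k / 2 ≤ (⌊η * k⌋₊ : ℝ) := by
    have := Nat.lt_floor_add_one (η * k)
    linarith
  have hm0 : (0 : ℝ) < (⌊η * k⌋₊ : ℝ) := by linarith
  have hpos := Nat.div_mul_le_self p (k - 1)
  have hlt := Nat.lt_div_mul_add (a := p) (b := k - 1) (by omega)
  -- With `r = k - 1 ≥ 7`, the product is at most `p + p/7 + p/4`.
  have hB2 : (p / (k - 1) + 1) * k ≤ 2 * p := by
    obtain ⟨r, rfl⟩ : ∃ r, k = r + 1 := ⟨k - 1, by omega⟩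
    rw [Nat.add_sub_cancel] at *
    have : 7 * (p / r) ≤ p := le_trans (by nlinarith) hpos
    nlinarith
  have hx : (4 : ℝ) ≤ (p : ℝ) / k := by
    rw [le_div_iff₀ hk0]
    exact_mod_cast hp
  have hlog0 : 0 < Real.log ((p : ℝ) / k) := Real.log_pos (by linarith)
  have hL : (Nat.clog 2 (p / (k - 1) + 1) : ℝ) ≤ 4 * Real.log ((p : ℝ) / k) := by
    refine clog_le_four_mul_log hx ?_
    rw [← mul_div_assoc, le_div_iff₀ hk0]
    exact_mod_cast hB2
  obtain ⟨X, dec, h1, h2⟩ := exists_recoveryProb_ge (p := p) (k := k) (m := ⌊η * k⌋₊)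
    (B := p / (k - 1) + 1) (L := Nat.clog 2 (p / (k - 1) + 1)) (n := n)
    (δ := η * Real.exp (-8) / 4) hk hp (Nat.succ_pos _) (by nlinarith) hB2
    (by exact_mod_cast hm0)
    (by
      have : 2 * (⌊η * k⌋₊ : ℝ) ≤ k := by nlinarith
      exact_mod_cast this)
    (Nat.le_pow_clog one_lt_two _)
    (by
      refine Nat.cast_le (α := ℝ).1 ?_
      push_cast
      calc (⌊η * k⌋₊ : ℝ) * (Nat.clog 2 (p / (k - 1) + 1) : ℝ)
          ≤ (c / 4 * k) * (4 * Real.log ((p : ℝ) / k)) := by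
            refine mul_le_mul (hm1.trans (by gcongr)) hL (Nat.cast_nonneg _) ?_
            exact mul_nonneg (by linarith) hk0.le
        _ = c * (k * Real.log (p / k)) := by ring
        _ ≤ n := hn)
    (by nlinarith [Real.exp_pos (-8)])
  refine ⟨X, dec, h1, le_trans ?_ h2⟩
  have : 4 * Real.exp 8 / (⌊η * k⌋₊ : ℝ) ≤ 8 * Real.exp 8 / η / k := by
    rw [div_div, div_le_div_iff₀ hm0 (by positivity)]
    nlinarith [Real.exp_pos 8]
  rw [add_div]
  linarith

end GroupTesting

theorem mainTheorem8 (c : ℝ) (hc : 0 < c) :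
    ∃ δ : ℝ, 0 < δ ∧
      ∀ k n : ℕ → ℕ,
        Filter.Tendsto k Filter.atTop Filter.atTop →
        Asymptotics.IsLittleO Filter.atTop (fun p : ℕ => (k p : ℝ)) (fun p : ℕ => (p : ℝ)) →
        (∀ᶠ p : ℕ in Filter.atTop,
          c * ((k p : ℝ) * Real.log ((p : ℝ) / (k p : ℝ))) ≤ (n p : ℝ)) →
        ∃ (X : ∀ p : ℕ, Matrix (Fin (n p)) (Fin p) Bool)
          (dec : ∀ p : ℕ, (Fin (n p) → Bool) → Finset (Fin p)),
          (∀ p : ℕ, k p ≤ p → ∀ y : Fin (n p) → Bool, (dec p y).card = k p) ∧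
          Filter.Tendsto (fun p : ℕ => GroupTesting.recoveryProb (k p) (X p) (dec p) δ)
            Filter.atTop (nhds 1) := by
  obtain ⟨η, hη, hηc, hη2⟩ : ∃ η : ℝ, 0 < η ∧ η ≤ c / 4 ∧ η ≤ 1 / 2 :=
    ⟨min (c / 4) (1 / 2), by positivity, min_le_left _ _, min_le_right _ _⟩
  -- One factor `1/2` comes from Chebyshev, the other from `⌊ηk⌋ ≥ ηk/2`.
  refine ⟨η * Real.exp (-8) / 4, by positivity, fun k n hk hkp hn => ?_⟩
  have hkR : Filter.Tendsto (fun p => (k p : ℝ)) Filter.atTop Filter.atTop :=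
    tendsto_natCast_atTop_atTop.comp hk
  have hex : ∀ p, ∃ (X : Matrix (Fin (n p)) (Fin p) Bool)
      (dec : (Fin (n p) → Bool) → Finset (Fin p)),
      (k p ≤ p → ∀ y, (dec y).card = k p) ∧
      (8 ≤ k p → 2 ≤ η * k p → 4 * k p ≤ p →
        c * ((k p : ℝ) * Real.log ((p : ℝ) / (k p : ℝ))) ≤ (n p : ℝ) →
        1 - (8 * Real.exp 8 / η + 16) / k p ≤
          GroupTesting.recoveryProb (k p) X dec (η * Real.exp (-8) / 4)) := by
    intro p
    by_cases h : 8 ≤ k p ∧ 2 ≤ η * k p ∧ 4 * k p ≤ p ∧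
        c * ((k p : ℝ) * Real.log ((p : ℝ) / (k p : ℝ))) ≤ (n p : ℝ)
    · obtain ⟨X, dec, h1, h2⟩ :=
        GroupTesting.exists_recoveryProb_ge_of_le hη hηc hη2 h.1 h.2.1 h.2.2.1 h.2.2.2
      exact ⟨X, dec, fun _ => h1, fun _ _ _ _ => h2⟩
    -- Only finitely many `p` land here, so any decoder of the right output size will do.
    · by_cases hp : k p ≤ p
      · obtain ⟨D, -, hD⟩ := Finset.exists_subset_card_eq
          (show k p ≤ (Finset.univ : Finset (Fin p)).card by simpa using hp)
        exact ⟨fun _ _ => false, fun _ => D, fun _ _ => hD,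
          fun h1 h2 h3 h4 => absurd ⟨h1, h2, h3, h4⟩ h⟩
      · exact ⟨fun _ _ => false, fun _ => ∅, fun h' => absurd h' hp,
          fun h1 h2 h3 h4 => absurd ⟨h1, h2, h3, h4⟩ h⟩
  choose X dec hcard hprob using hex
  refine ⟨X, dec, hcard, ?_⟩
  have h4 : ∀ᶠ p : ℕ in Filter.atTop, 4 * k p ≤ p := by
    filter_upwards [hkp.bound (show (0 : ℝ) < 1 / 4 by norm_num)] with p hp
    simp only [RCLike.norm_natCast] at hp
    have : 4 * (k p : ℝ) ≤ p := by linarith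
    exact_mod_cast this
  have hlim : Filter.Tendsto (fun p => 1 - (8 * Real.exp 8 / η + 16) / (k p : ℝ))
      Filter.atTop (nhds 1) := by
    simpa using (hkR.const_div_atTop (8 * Real.exp 8 / η + 16)).const_sub 1
  refine tendsto_of_tendsto_of_tendsto_of_le_of_le' hlim tendsto_const_nhds ?_ ?_
  · filter_upwards [h4, hk.eventually_ge_atTop 8, hkR.eventually_ge_atTop (2 / η), hn]
      with p h4 h8 hη' hn
    exact hprob p h8 (by rwa [div_le_iff₀' hη] at hη') h4 hn
  · filter_upwards [h4] with p h4
    exact GroupTesting.uniformProb_le_one (by omega) _
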